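/- Let $E$ be a finite set with at least two elements, let $\lambda : E \to \,]0,\infty[$, and let $q = (q(i,j))_{i,j\in E}$ be an irreducible stochastic matrix with $q(i,i) = 0$ for all $i \in E$. Let $X = (X_t)_{t\ge 0}$ be the Markov jump process on $E$ with intensity function $\lambda$ and jump kernel $q$, that is, the right-continuous Markov process with transition matrices $e^{tG}$, where $G_{ij} = \lambda(i)\,(q(i,j) - \mathbf{1}_{i=j})$; write $\mathbb{E}_i$ for the expectation when $X_0 = i$, and let $\mu$ be the invariant probability measure of $X$. Let $a : E \to \mathbb{R}$ satisfy $$\sum_{i\in E} a(i)\mu(i) < 0 \qquad\text{and}\qquad a(i) > 0 \text{ for at least one } i \in E .$$ For $s > 0$ and $\delta > 0$ let $A_{(s,\delta)}$ be the matrix with entries $$(A_{(s,\delta)})_{ij} = \mathbb{E}_i\Big[\exp\Big(\int_0^\delta a(X_u)\,du\Big)^{s}\, \mathbf{1}_{X_\delta = j}\Big], \qquad i,j\in E .$$ Put $s_1 = \min\{\lambda(i)/a(i) : i \in E,\ a(i) > 0\}$ and, for $0 \le s < s_1$, $$M_s = \Big(q(i,j)\,\frac{\lambda(i)}{\lambda(i)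 - s\,a(i)}\Big)_{i,j\in E}.$$ Let $\rho$ denote the spectral radius. Then there is a unique $s \in \,]0,s_1[$ with $\rho(M_s) = 1$. Moreover there is a unique $\kappa > 0$ with $\rho(A_{(\kappa,\delta)}) = 1$; it does not depend on $\delta > 0$, and it equals this $s$. -/

import Mathlib

open MeasureTheory Filter Topology
open scoped NNReal ENNReal

noncomputable section

namespace MarkovSwitching

variable {E : Type*}

/-- The infinitesimal generator of the jump process on the finite set `E` with intensity function
`lam` and jump kernel `q`: the entry `(i, j)` is `lam i * (q i j - 1_{i = j})`. -/
def generator [DecidableEq E] (lam : E → ℝ) (q : Matrix E E ℝ) : Matrix E E ℝ :=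
  Matrix.of fun i j => lam i * (q i j - if i = j then 1 else 0)

/-- The transition matrix over a time span `t` of that jump process, `exp (t G)`. -/
def transition [Fintype E] [DecidableEq E] (lam : E → ℝ) (q : Matrix E E ℝ) (t : ℝ≥0) :
    Matrix E E ℝ :=
  NormedSpace.exp ((t : ℝ) • generator lam q)

/-- `X` is, under the family of probability measures `P i` (`i` being the starting state), a
Markov jump process with intensity function `lam` and jump kernel `q`: its paths are
right-continuous for the discrete topology of `E`, and its finite-dimensional distributions are
those of the Markov process with transition matrices `exp (t G)`. -/
structure IsMarkovJumpProcess [Fintype E] [DecidableEq E] {Ω : Type*} [MeasurableSpace Ω]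
    (lam : E → ℝ) (q : Matrix E E ℝ) (P : E → Measure Ω) (X : ℝ≥0 → Ω → E) : Prop where
  isProbabilityMeasure : ∀ i, IsProbabilityMeasure (P i)
  measurableSet_eq : ∀ t j, MeasurableSet {ω | X t ω = j}
  right_continuous : ∀ ω t, ∀ᶠ u in 𝓝[≥] t, X u ω = X t ω
  finite_dim : ∀ (n : ℕ) (t : Fin (n + 1) → ℝ≥0) (x : Fin (n + 1) → E), Monotone t → t 0 = 0 →
    (P (x 0)).real {ω | ∀ k, X (t k) ω = x k} =
      ∏ k : Fin n, transition lam q (t k.succ - t k.castSucc) (x k.castSucc) (x k.succ)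

/-- `μ` is (the weight function of) an invariant probability measure of the process `X` with
laws `P i`. -/
structure IsInvariantLaw [Fintype E] {Ω : Type*} [MeasurableSpace Ω]
    (P : E → Measure Ω) (X : ℝ≥0 → Ω → E) (μ : E → ℝ) : Prop where
  nonneg : ∀ i, 0 ≤ μ i
  sum_eq_one : ∑ i, μ i = 1
  invariant : ∀ (t : ℝ≥0) (j : E), ∑ i, μ i * (P i).real {ω | X t ω = j} = μ j

/-- `Φ₁(δ) = exp ∫₀^δ a(X_u) du`. -/
def Phi {Ω : Type*} (a : E → ℝ) (X : ℝ≥0 → Ω → E) (δ : ℝ≥0) (ω : Ω) : ℝ :=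
  Real.exp (∫ u in (0 : ℝ)..δ, a (X u.toNNReal ω))

/-- The matrix `A_{(s,δ)}` of the operator `φ ↦ (i ↦ 𝔼_i[Φ₁(δ)^s φ(X_δ)])`: its entry `(i, j)` is
`𝔼_i[Φ₁(δ)^s 1_{X_δ = j}]`. -/
def matA [DecidableEq E] {Ω : Type*} [MeasurableSpace Ω] (a : E → ℝ) (P : E → Measure Ω)
    (X : ℝ≥0 → Ω → E) (s : ℝ) (δ : ℝ≥0) : Matrix E E ℝ :=
  Matrix.of fun i j => ∫ ω, Phi a X δ ω ^ s * (if X δ ω = j then 1 else 0) ∂(P i)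

/-- The matrix `M_s`, with entries `q(i,j) λ(i) / (λ(i) - s a(i))`. -/
def matM (lam a : E → ℝ) (q : Matrix E E ℝ) (s : ℝ) : Matrix E E ℝ :=
  Matrix.of fun i j => q i j * (lam i / (lam i - s * a i))

/-- `s₁ = min {λ(i) / a(i) | a(i) > 0}` (the minimum of a finite set, nonempty as soon as some
`a(i)` is positive). -/
def sOne (lam a : E → ℝ) : ℝ :=
  sInf ((fun i => lam i / a i) '' {i | 0 < a i})

/-- The spectral radius of a real square matrix: the largest modulus of its complex
eigenvalues. -/
def rho [Fintype E] [DecidableEq E] (A : Matrix E E ℝ) : ℝ≥0∞ :=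
  spectralRadius ℂ (A.map (algebraMap ℝ ℂ))

end MarkovSwitching

end

open MarkovSwitching

/-! Both spectral conditions reduce to one: the tilted generator `B_s = G + s diag a` has a strictly
positive kernel vector. For `s < s₁`, clearing denominators row by row turns `M_s v = v` into `B_s v
= 0` (`matM_mulVec_eq_self_iff`). The Feynman–Kac formula `A_{(s,δ)} = exp (δ B_s)` (`matA_eq_exp`),
obtained from Riemann sums and the Lie–Trotter product, turns an eigenvalue `r` of `B_s` into the
eigenvalue `exp (δ r)`. A nonnegative matrix with a positive eigenvector has the corresponding
eigenvalue as spectral radius (`rho_eq_of_pos_eigenvector`), so everything rests on the zeros of the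
Perron eigenvalue `r(s)` of `B_s`.

Existence of a zero in `]0, s₁[` is the intermediate value theorem (`exists_unique_pos_kernel`). The
slope of `r` at `0` is the mean of `a` under `μ`, which is negative; a test vector built from a
Poisson equation makes this quantitative. At `s₁` some diagonal entry of `B_s` vanishes, which
forces `r(s₁) > 0`.

Uniqueness (`not_lt_of_pos_kernel`) replaces convexity of `r` by Bernoulli's inequality: if `B_t w =
0` and `0 < s < t`, then `w ^ (s/t)` is a supersolution for `B_s`. A positive kernel vector of `B_s`
would force equality, hence `w` constant and `a = 0`. -/

namespace MarkovSwitching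

/-! ### Irreducible matrices, comparison principles and the Perron eigenvector -/

section PerronFrobenius

variable {E : Type*}

/-- Irreducibility only depends on the positivity pattern of the entries, monotonically. -/
theorem isIrreducible_of_pos_imp_pos {A B : Matrix E E ℝ} (hA : A.IsIrreducible)
    (hB : ∀ i j, 0 ≤ B i j) (h : ∀ i j, 0 < A i j → 0 < B i j) : B.IsIrreducible := by
  refine ⟨hB, fun i j => ?_⟩
  obtain ⟨p, hp⟩ := hA.connected i j
  let F : @Prefunctor E A.toQuiver E B.toQuiver :=
    @Prefunctor.mk E A.toQuiver E B.toQuiver id fun {i j} e => ⟨h i j e.down⟩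
  have hlen : ∀ {j : E} (p : @Quiver.Path E A.toQuiver i j),
      @Quiver.Path.length E B.toQuiver _ _ (@Prefunctor.mapPath E A.toQuiver E B.toQuiver F i j p) =
        @Quiver.Path.length E A.toQuiver i j p := by
    let _ := A.toQuiver
    intro j p
    induction p with
    | nil => rfl
    | cons p e ih => exact congrArg (· + 1) ih
  exact ⟨@Prefunctor.mapPath E A.toQuiver E B.toQuiver F i j p, by rw [hlen]; exact hp⟩

/-- A nonempty set of states that is closed under the transitions of an irreducible matrix is
everything. -/
theorem mem_of_isIrreducible {A : Matrix E E ℝ} (hA : A.IsIrreducible) {S : Set E} {i : E}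
    (hi : i ∈ S) (hS : ∀ i ∈ S, ∀ j, 0 < A i j → j ∈ S) (j : E) : j ∈ S := by
  obtain ⟨p, -⟩ := hA.connected i j
  let _ := A.toQuiver
  induction p with
  | nil => exact hi
  | cons p e ih => exact hS _ ih _ e.down

variable [Fintype E]

/-- If `B` is nonnegative off the diagonal and `z ≥ 0` vanishes at `i`, then `(B z) i ≥ 0`. -/
theorem mulVec_nonneg_of_apply_eq_zero {B : Matrix E E ℝ} (hB : ∀ i j, i ≠ j → 0 ≤ B i j)
    {z : E → ℝ} (hz : ∀ i, 0 ≤ z i) {i : E} (hi : z i = 0) : 0 ≤ (B.mulVec z) i := by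
  refine Finset.sum_nonneg fun j _ => ?_
  by_cases h : i = j
  · subst h; simp [hi]
  · exact mul_nonneg (hB i j h) (hz j)

/-- Minimum principle: a nonnegative supersolution `B z ≤ 0` that vanishes somewhere vanishes
everywhere. -/
theorem eq_zero_of_mulVec_nonpos {A B : Matrix E E ℝ} (hA : A.IsIrreducible)
    (hB : ∀ i j, i ≠ j → 0 ≤ B i j) (hAB : ∀ i j, i ≠ j → 0 < A i j → 0 < B i j)
    {z : E → ℝ} (hz : ∀ i, 0 ≤ z i) {i : E} (hi : z i = 0) (hBz : ∀ i, (B.mulVec z) i ≤ 0) :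
    z = 0 := by
  funext j
  refine mem_of_isIrreducible hA (S := {j | z j = 0}) hi (fun k hk l hkl => ?_) j
  by_cases hne : k = l
  · exact hne ▸ hk
  have hterm : ∀ m ∈ Finset.univ, 0 ≤ B k m * z m := fun m _ => by
    by_cases h : k = m
    · subst h; simp [show z k = 0 from hk]
    · exact mul_nonneg (hB k m h) (hz m)
  have hsum : ∑ m, B k m * z m = 0 :=
    le_antisymm (hBz k) (Finset.sum_nonneg hterm)
  have := (Finset.sum_eq_zero_iff_of_nonneg hterm).1 hsum l (Finset.mem_univ l)
  exact (mul_eq_zero.1 this).resolve_left (hAB k l hne hkl).ne'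

/-- Among the multiples of `w` above `v` there is one that touches `v`. -/
theorem exists_touching_multiple [Nonempty E] (v : E → ℝ) {w : E → ℝ} (hw : ∀ i, 0 < w i) :
    ∃ c : ℝ, (∀ j, v j ≤ c * w j) ∧ ∃ i, v i = c * w i := by
  obtain ⟨i, hi⟩ := Finite.exists_max fun i => v i / w i
  refine ⟨v i / w i, fun j => ?_, i, ?_⟩
  · exact (div_le_iff₀ (hw j)).1 (hi j)
  · rw [div_mul_cancel₀ _ (hw i).ne']

/-- Collatz–Wielandt comparison: sub- and super-eigenvalues of a matrix that is nonnegative off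
the diagonal are ordered. -/
theorem le_of_mulVec_bounds [Nonempty E] {B : Matrix E E ℝ} (hB : ∀ i j, i ≠ j → 0 ≤ B i j)
    {v w : E → ℝ} (hv : ∀ i, 0 < v i) (hw : ∀ i, 0 < w i) {c r : ℝ}
    (hc : ∀ i, c * v i ≤ (B.mulVec v) i) (hr : ∀ i, (B.mulVec w) i ≤ r * w i) : c ≤ r := by
  obtain ⟨C, hC, i, hi⟩ := exists_touching_multiple v hw
  have h := mulVec_nonneg_of_apply_eq_zero hB (z := C • w - v) (i := i)
    (fun j => by simpa using hC j) (by simp [hi])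
  rw [Matrix.mulVec_sub, Matrix.mulVec_smul] at h
  simp only [Pi.sub_apply, Pi.smul_apply, smul_eq_mul] at h
  have hCpos : 0 < C := by
    have := hv i
    rw [hi] at this
    exact pos_of_mul_pos_left this (hw i).le
  have h1 := hc i
  have h2 := mul_le_mul_of_nonneg_left (hr i) hCpos.le
  have h3 : c * v i ≤ r * v i := by rw [hi] at h1 ⊢; linarith
  exact le_of_mul_le_mul_right h3 (hv i)

variable [DecidableEq E]

/-- Each entry is positive in some power and nonnegative in the others, so finitely many powers
suffice. The sum commutes with `A` and makes every nonzero nonnegative vector strictly positive,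
which is its use in the Perron–Frobenius theorem. -/
theorem exists_sum_pow_pos {A : Matrix E E ℝ} (hA : A.IsIrreducible) :
    ∃ N : ℕ, ∀ i j, 0 < (∑ k ∈ Finset.range N, A ^ k) i j := by
  have h := (Matrix.isIrreducible_iff_exists_pow_pos hA.nonneg).1 hA
  choose k hk using h
  have hpow : ∀ (n : ℕ) i j, 0 ≤ (A ^ n) i j := fun n => by
    induction n with
    | zero => intro i j; simp only [pow_zero, Matrix.one_apply]; split_ifs <;> norm_num
    | succ n ih =>
      intro i j
      rw [pow_succ, Matrix.mul_apply]
      exact Finset.sum_nonneg fun l _ => mul_nonneg (ih i l) (hA.nonneg l j)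
  obtain ⟨N, hN⟩ := (Set.finite_range fun p : E × E => k p.1 p.2).bddAbove
  refine ⟨N + 1, fun i j => ?_⟩
  rw [Matrix.sum_apply]
  refine Finset.sum_pos' (fun n _ => hpow n i j) ⟨k i j, ?_, (hk i j).2⟩
  have : k i j ≤ N := hN ⟨(i, j), rfl⟩
  exact Finset.mem_range.2 (by omega)

/-- **Perron–Frobenius**: an irreducible nonnegative matrix has a positive eigenvector. -/
theorem exists_pos_eigenvector [Nonempty E] {A : Matrix E E ℝ} (hA : A.IsIrreducible) :
    ∃ (r : ℝ) (v : E → ℝ), (∀ i, 0 < v i) ∧ A.mulVec v = r • v := by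
  have hbound : ∀ v ∈ stdSimplex ℝ E, ∀ r : ℝ, (∀ i, r * v i ≤ (A.mulVec v) i) →
      r ≤ ∑ i, ∑ j, A i j := by
    intro v hv r hr
    calc r = ∑ i, r * v i := by rw [← Finset.mul_sum, hv.2, mul_one]
      _ ≤ ∑ i, ∑ j, A i j * v j := Finset.sum_le_sum fun i _ => hr i
      _ ≤ ∑ i, ∑ j, A i j := by
        refine Finset.sum_le_sum fun i _ => Finset.sum_le_sum fun j _ => ?_
        refine mul_le_of_le_one_right (hA.nonneg i j) ?_
        rw [← hv.2]
        exact Finset.single_le_sum (fun k _ => hv.1 k) (Finset.mem_univ j)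
  let R := ∑ i, ∑ j, A i j
  -- Collatz–Wielandt: the eigenvalue is the largest `r` with `r v ≤ A v` for some probability
  -- vector `v`. The bound `R` makes the set of admissible pairs compact.
  let S : Set ((E → ℝ) × ℝ) := (stdSimplex ℝ E ×ˢ Set.Icc 0 R) ∩
    {p | ∀ i, p.2 * p.1 i ≤ (A.mulVec p.1) i}
  have hScompact : IsCompact S := by
    refine ((isCompact_stdSimplex ℝ E).prod isCompact_Icc).inter_right ?_
    simp only [Set.ofPred_forall]
    refine isClosed_iInter fun i => isClosed_le (by fun_prop) ?_
    simp only [Matrix.mulVec, dotProduct]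
    fun_prop
  have hSne : S.Nonempty := by
    obtain ⟨i⟩ := ‹Nonempty E›
    have hmem := single_mem_stdSimplex ℝ i
    have h0 : ∀ k, (0 : ℝ) * (Pi.single i 1 : E → ℝ) k ≤ (A.mulVec (Pi.single i 1)) k :=
      fun k => by
        rw [zero_mul]
        exact Finset.sum_nonneg fun j _ => mul_nonneg (hA.nonneg k j) (hmem.1 j)
    exact ⟨(Pi.single i 1, 0), ⟨hmem, le_rfl, hbound _ hmem 0 h0⟩, h0⟩
  obtain ⟨⟨v, r⟩, ⟨⟨hv, hr0, hrR⟩, hvr⟩, hmax⟩ :=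
    hScompact.exists_isMaxOn hSne continuous_snd.continuousOn
  simp only at hv hr0 hvr
  obtain ⟨N, hN⟩ := exists_sum_pow_pos hA
  set P := ∑ k ∈ Finset.range N, A ^ k with hP
  have hPpos : ∀ z : E → ℝ, (∀ i, 0 ≤ z i) → z ≠ 0 → ∀ i, 0 < (P.mulVec z) i := by
    intro z hz hz0 i
    obtain ⟨j, hj⟩ := Function.ne_iff.1 hz0
    exact Finset.sum_pos' (fun k _ => mul_nonneg (hN i k).le (hz k))
      ⟨j, Finset.mem_univ j, mul_pos (hN i j) (lt_of_le_of_ne (hz j) (Ne.symm hj))⟩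
  have hv0 : v ≠ 0 := by
    rintro rfl
    simpa using hv.2
  have hcomm : A * P = P * A := by
    rw [hP, Finset.mul_sum, Finset.sum_mul]
    exact Finset.sum_congr rfl fun k _ => (Commute.self_pow A k)
  have heig : A.mulVec v = r • v := by
    by_contra hne
    -- If the gap `z ≥ 0` were nonzero, applying `P` would make it positive in every coordinate,
    -- leaving room to raise `r` by `ε` with `P v`, normalised, as the new vector.
    set z := A.mulVec v - r • v with hz
    have hz0 : z ≠ 0 := sub_ne_zero.2 hne
    have hznn : ∀ i, 0 ≤ z i := fun i => by simpa [hz] using hvr i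
    set y := P.mulVec v with hy
    have hypos := hPpos v hv.1 hv0
    have hzpos := hPpos z hznn hz0
    have hAy : A.mulVec y = r • y + P.mulVec z := by
      rw [hz, hy, Matrix.mulVec_sub, Matrix.mulVec_smul, Matrix.mulVec_mulVec,
        Matrix.mulVec_mulVec, hcomm]
      abel
    obtain ⟨i₀, hi₀⟩ := Finite.exists_min fun i => (P.mulVec z) i / y i
    set ε := (P.mulVec z) i₀ / y i₀ with hε
    have hεpos : 0 < ε := div_pos (hzpos i₀) (hypos i₀)
    have hT : 0 < ∑ i, y i := Finset.sum_pos (fun i _ => hypos i) Finset.univ_nonempty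
    set T := ∑ i, y i with hTdef
    have hmem : T⁻¹ • y ∈ stdSimplex ℝ E :=
      ⟨fun i => mul_nonneg (inv_nonneg.2 hT.le) (hypos i).le, by
        simp only [Pi.smul_apply, smul_eq_mul]
        rw [← Finset.mul_sum, inv_mul_cancel₀ hT.ne']⟩
    have hle : ∀ i, (r + ε) * (T⁻¹ • y) i ≤ (A.mulVec (T⁻¹ • y)) i := fun i => by
      rw [Matrix.mulVec_smul, hAy]
      have := (le_div_iff₀ (hypos i)).1 (hi₀ i)
      simp only [Pi.smul_apply, Pi.add_apply, smul_eq_mul]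
      have h2 := mul_le_mul_of_nonneg_left this (inv_nonneg.2 hT.le)
      linarith
    have h := hmax (a := (T⁻¹ • y, r + ε)) ⟨⟨hmem, by positivity, hbound _ hmem _ hle⟩, hle⟩
    simp only [Set.mem_ofPred_eq] at h
    linarith
  refine ⟨r, v, fun i => lt_of_le_of_ne (hv.1 i) fun h0 => ?_, heig⟩
  -- Since `P v` is a multiple of the eigenvector `v`, a zero of `v` would be a zero of the strictly
  -- positive vector `P v`.
  have hpow : ∀ k : ℕ, (A ^ k).mulVec v = r ^ k • v := fun k => by
    induction k with
    | zero => simp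
    | succ k ih => rw [pow_succ, ← Matrix.mulVec_mulVec, heig, Matrix.mulVec_smul, ih, smul_smul,
        pow_succ, mul_comm]
  have := hPpos v hv.1 hv0 i
  rw [hP, Matrix.sum_mulVec] at this
  simp [hpow, ← h0] at this

/-- The spectral radius of a nonnegative matrix with a positive eigenvector is the corresponding
eigenvalue. -/
theorem rho_eq_of_pos_eigenvector [Nonempty E] {A : Matrix E E ℝ} (hA : ∀ i j, 0 ≤ A i j)
    {v : E → ℝ} (hv : ∀ i, 0 < v i) {r : ℝ} (h : A.mulVec v = r • v) :
    rho A = ENNReal.ofReal r := by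
  have hspec : ∀ z : ℂ, z ∈ spectrum ℂ (A.map (algebraMap ℝ ℂ)) ↔
      ∃ w : E → ℂ, w ≠ 0 ∧ (A.map (algebraMap ℝ ℂ)).mulVec w = z • w := by
    intro z
    rw [← Matrix.spectrum_toLin', ← Module.End.hasEigenvalue_iff_mem_spectrum]
    constructor
    · intro hz
      obtain ⟨w, hw⟩ := hz.exists_hasEigenvector
      exact ⟨w, hw.2, by simpa using hw.apply_eq_smul⟩
    · rintro ⟨w, hw0, hw⟩
      exact Module.End.hasEigenvalue_of_hasEigenvector
        (x := w) ⟨Module.End.mem_eigenspace_iff.2 (by simpa using hw), hw0⟩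
  have hr : 0 ≤ r := by
    obtain ⟨i⟩ := ‹Nonempty E›
    have h1 : 0 ≤ (A.mulVec v) i := Finset.sum_nonneg fun j _ => mul_nonneg (hA i j) (hv j).le
    rw [h] at h1
    exact nonneg_of_mul_nonneg_left h1 (hv i)
  apply le_antisymm
  · refine iSup₂_le fun z hz => ?_
    obtain ⟨w, hw0, hw⟩ := (hspec z).1 hz
    -- At the coordinate where `c v` touches `|w|`, the triangle inequality in the eigenvalue
    -- equation yields `|z| ≤ r`.
    obtain ⟨c, hc, i, hi⟩ := exists_touching_multiple (fun j => ‖w j‖) hv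
    have hcpos : 0 < c := by
      obtain ⟨j, hj⟩ := Function.ne_iff.1 hw0
      have : 0 < c * v j := (norm_pos_iff.2 hj).trans_le (hc j)
      exact pos_of_mul_pos_left this (hv j).le
    have hwi : 0 < ‖w i‖ := by rw [hi]; exact mul_pos hcpos (hv i)
    have key : ‖z‖ * ‖w i‖ ≤ r * ‖w i‖ := by
      calc ‖z‖ * ‖w i‖ = ‖∑ j, ((A i j : ℝ) : ℂ) * w j‖ := by
            rw [← norm_mul]
            exact congrArg norm (congrFun hw i).symm
        _ ≤ ∑ j, A i j * ‖w j‖ := by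
            refine (norm_sum_le _ _).trans (le_of_eq (Finset.sum_congr rfl fun j _ => ?_))
            rw [norm_mul, Complex.norm_real, Real.norm_of_nonneg (hA i j)]
        _ ≤ ∑ j, A i j * (c * v j) :=
            Finset.sum_le_sum fun j _ => mul_le_mul_of_nonneg_left (hc j) (hA i j)
        _ = c * (A.mulVec v) i := by
            simp only [Matrix.mulVec, dotProduct, Finset.mul_sum]
            exact Finset.sum_congr rfl fun j _ => by ring
        _ = r * ‖w i‖ := by
            rw [h, hi]; simp only [Pi.smul_apply, smul_eq_mul]; ring
    have hz' := le_of_mul_le_mul_right key hwi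
    rw [ENNReal.ofReal, ENNReal.coe_le_coe]
    exact (Real.le_toNNReal_iff_coe_le hr).2 (by simpa using hz')
  · have hmem : (r : ℂ) ∈ spectrum ℂ (A.map (algebraMap ℝ ℂ)) := by
      refine (hspec r).2 ⟨fun i => (v i : ℂ), ?_, ?_⟩
      · obtain ⟨i⟩ := ‹Nonempty E›
        exact Function.ne_iff.2 ⟨i, by simpa using (hv i).ne'⟩
      · funext i
        have := congrFun h i
        simp only [Matrix.mulVec, dotProduct, Pi.smul_apply, smul_eq_mul] at this ⊢
        simp only [Matrix.map_apply, Complex.coe_algebraMap]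
        exact_mod_cast this
    refine le_trans (le_of_eq ?_) (le_iSup₂ (f := fun k (_ : k ∈ spectrum ℂ
      (A.map (algebraMap ℝ ℂ))) => (‖k‖₊ : ℝ≥0∞)) (r : ℂ) hmem)
    rw [ENNReal.ofReal, ENNReal.coe_inj]
    ext
    simp [abs_of_nonneg hr, hr]

end PerronFrobenius

/-! ### The tilted generator, the Poisson equation and uniqueness -/

section Tilted

variable {E : Type*} [DecidableEq E]

/-- The generator tilted by the potential `s a`, that is, `G + s diag a`. -/
noncomputable def tiltedGenerator (lam a : E → ℝ) (q : Matrix E E ℝ) (s : ℝ) : Matrix E E ℝ :=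
  generator lam q + Matrix.diagonal fun i => s * a i

variable {lam a : E → ℝ} {q : Matrix E E ℝ}

theorem tiltedGenerator_apply_of_ne (s : ℝ) {i j : E} (h : i ≠ j) :
    tiltedGenerator lam a q s i j = lam i * q i j := by
  simp [tiltedGenerator, generator, h]

theorem tiltedGenerator_nonneg_of_ne (hlam : ∀ i, 0 < lam i) (hq : ∀ i j, 0 ≤ q i j) (s : ℝ)
    (i j : E) (h : i ≠ j) : 0 ≤ tiltedGenerator lam a q s i j := by
  rw [tiltedGenerator_apply_of_ne s h]
  exact mul_nonneg (hlam i).le (hq i j)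

theorem tiltedGenerator_pos_of_ne (hlam : ∀ i, 0 < lam i) (s : ℝ)
    (i j : E) (h : i ≠ j) (hij : 0 < q i j) : 0 < tiltedGenerator lam a q s i j := by
  rw [tiltedGenerator_apply_of_ne s h]
  exact mul_pos (hlam i) hij

variable [Fintype E]

theorem tiltedGenerator_mulVec (s : ℝ) (v : E → ℝ) (i : E) :
    ((tiltedGenerator lam a q s).mulVec v) i =
      lam i * ((q.mulVec v) i - v i) + s * a i * v i := by
  rw [tiltedGenerator, Matrix.add_mulVec, Pi.add_apply, Matrix.mulVec_diagonal]
  congr 1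
  simp only [generator, Matrix.mulVec, dotProduct, Matrix.of_apply]
  rw [← Finset.sum_ite_eq Finset.univ i v |>.trans (if_pos (Finset.mem_univ i)),
    ← Finset.sum_sub_distrib, Finset.mul_sum]
  refine Finset.sum_congr rfl fun j _ => ?_
  split_ifs <;> ring

/-- A large multiple of the identity makes `B` nonnegative and irreducible; it shifts eigenvalues
and keeps eigenvectors, so Perron–Frobenius applies. -/
theorem exists_pos_eigenvector_of_offDiag [Nonempty E] {A B : Matrix E E ℝ}
    (hA : A.IsIrreducible) (hAdiag : ∀ i, A i i = 0) (hB : ∀ i j, i ≠ j → 0 ≤ B i j)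
    (hAB : ∀ i j, i ≠ j → 0 < A i j → 0 < B i j) :
    ∃ (r : ℝ) (v : E → ℝ), (∀ i, 0 < v i) ∧ B.mulVec v = r • v := by
  set c := ∑ i, |B i i| with hc
  have hirr : (B + c • (1 : Matrix E E ℝ)).IsIrreducible := by
    refine isIrreducible_of_pos_imp_pos hA (fun i j => ?_) fun i j hij => ?_
    · by_cases h : i = j
      · subst h
        have : |B i i| ≤ c :=
          Finset.single_le_sum (f := fun i => |B i i|) (fun k _ => abs_nonneg _)
            (Finset.mem_univ i)
        simp only [Matrix.add_apply, Matrix.smul_apply, Matrix.one_apply_eq, smul_eq_mul, mul_one]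
        linarith [neg_abs_le (B i i)]
      · simpa [Matrix.one_apply_ne h] using hB i j h
    · have h : i ≠ j := by
        rintro rfl
        exact hij.ne' (hAdiag i)
      simpa [Matrix.one_apply_ne h] using hAB i j h hij
  obtain ⟨r, v, hv, h⟩ := exists_pos_eigenvector hirr
  refine ⟨r - c, v, hv, ?_⟩
  rw [Matrix.add_mulVec, Matrix.smul_mulVec, Matrix.one_mulVec] at h
  rw [sub_smul, ← h]
  abel

/-- Solvability of the Poisson equation: a function with zero mean under an invariant probability
vector `μ` is in the range of the generator. -/
theorem exists_generator_mulVec_eq [Nonempty E] (hlam : ∀ i, 0 < lam i)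
    (hq : q ∈ Matrix.rowStochastic ℝ E) (hq_irr : q.IsIrreducible) {μ : E → ℝ}
    (hμ1 : ∑ i, μ i = 1) (hμG : Matrix.vecMul μ (generator lam q) = 0) {f : E → ℝ}
    (hf : μ ⬝ᵥ f = 0) : ∃ h : E → ℝ, (generator lam q).mulVec h = f := by
  set G := generator lam q with hG
  have hG0 : tiltedGenerator lam 0 q 0 = G := by simp [tiltedGenerator, hG]
  -- The rank-one correction removes the kernel of `G`, the constants. As `μ G = 0`, pairing with
  -- `μ` shows that the preimage of a mean-zero `f` under `L` has mean zero, so there `L` agrees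
  -- with `G`.
  let L : (E → ℝ) →ₗ[ℝ] (E → ℝ) := (G - Matrix.vecMulVec 1 μ).mulVecLin
  have hL : ∀ h, L h = G.mulVec h - (μ ⬝ᵥ h) • (1 : E → ℝ) := fun h => by
    rw [Matrix.mulVecLin_apply, Matrix.sub_mulVec, Matrix.vecMulVec_mulVec]
    simp
  have hμ1' : μ ⬝ᵥ (1 : E → ℝ) = 1 := by rw [dotProduct_one, hμ1]
  have hmean : ∀ h, μ ⬝ᵥ L h = - (μ ⬝ᵥ h) := fun h => by
    rw [hL, dotProduct_sub, Matrix.dotProduct_mulVec, hμG, zero_dotProduct, dotProduct_smul, hμ1']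
    simp
  have hinj : Function.Injective L := by
    rw [← LinearMap.ker_eq_bot, LinearMap.ker_eq_bot']
    intro h hh
    have hm : μ ⬝ᵥ h = 0 := by
      have := hmean h
      rw [hh, dotProduct_zero] at this
      linarith
    have hGh : G.mulVec h = 0 := by
      have := hL h
      rw [hh, hm, zero_smul, sub_zero] at this
      exact this.symm
    obtain ⟨c, hc, i, hi⟩ := exists_touching_multiple h (w := 1) fun _ => one_pos
    have hz : c • (1 : E → ℝ) - h = 0 := by
      refine eq_zero_of_mulVec_nonpos (A := q) (B := G) (i := i) hq_irr
        (fun i j hij => ?_) (fun i j hij hpos => ?_) (fun j => ?_) ?_ fun j => ?_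
      · rw [← hG0]; exact tiltedGenerator_nonneg_of_ne hlam hq_irr.nonneg 0 i j hij
      · rw [← hG0]; exact tiltedGenerator_pos_of_ne hlam 0 i j hij hpos
      · simpa using hc j
      · simpa [sub_eq_zero] using hi.symm
      · rw [Matrix.mulVec_sub, hGh, Matrix.mulVec_smul, ← hG0, sub_zero, Pi.smul_apply,
          tiltedGenerator_mulVec, Matrix.one_vecMul_of_mem_rowStochastic hq]
        simp
    have hhc : h = c • (1 : E → ℝ) := (sub_eq_zero.1 hz).symm
    have hc0 : c = 0 := by
      rw [hhc, dotProduct_smul, hμ1'] at hm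
      simpa using hm
    rw [hhc, hc0, zero_smul]
  obtain ⟨h, hh⟩ := LinearMap.surjective_of_injective hinj f
  refine ⟨h, ?_⟩
  have hm : μ ⬝ᵥ h = 0 := by
    have := hmean h
    rw [hh, hf] at this
    linarith
  have := hL h
  rw [hh, hm, zero_smul, sub_zero] at this
  exact this.symm

/-- Two different positive values of the parameter cannot both have a positive vector in the
kernel of the tilted generator. -/
theorem not_lt_of_pos_kernel [Nonempty E] (hlam : ∀ i, 0 < lam i)
    (hq : q ∈ Matrix.rowStochastic ℝ E) (hq_irr : q.IsIrreducible) (ha : ∃ i, a i ≠ 0)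
    {s t : ℝ} (hs : 0 < s) {v w : E → ℝ} (hv : ∀ i, 0 < v i) (hw : ∀ i, 0 < w i)
    (hsv : (tiltedGenerator lam a q s).mulVec v = 0)
    (htw : (tiltedGenerator lam a q t).mulVec w = 0) : ¬ s < t := by
  intro hst
  have ht : 0 < t := hs.trans hst
  set θ := s / t with hθ
  have hθ0 : 0 < θ := div_pos hs ht
  have hθ1 : θ < 1 := (div_lt_one ht).2 hst
  have hsθ : s = θ * t := (div_mul_cancel₀ s ht.ne').symm
  set u : E → ℝ := fun i => w i ^ θ with hu
  have hupos : ∀ i, 0 < u i := fun i => Real.rpow_pos_of_pos (hw i) θ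
  have hx : ∀ i j, u j = u i * (1 + (w j / w i - 1)) ^ θ := fun i j => by
    rw [add_sub_cancel, Real.div_rpow (hw j).le (hw i).le, mul_div_cancel₀ _ (hupos i).ne']
  have hxge : ∀ i j, -1 ≤ w j / w i - 1 := fun i j => by
    have := div_pos (hw j) (hw i)
    linarith
  have hule : ∀ i j, u j ≤ u i * (1 + θ * (w j / w i - 1)) := fun i j => by
    rw [hx i j]
    exact mul_le_mul_of_nonneg_left
      (rpow_one_add_le_one_add_mul_self (hxge i j) hθ0.le hθ1.le) (hupos i).le
  have hrow : ∀ i, ∑ j, q i j = 1 := fun i => Matrix.sum_row_of_mem_rowStochastic hq i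
  -- With Bernoulli's upper bound in place of `u j`, the row equation is `θ u i / w i` times the
  -- kernel equation for `w` at `t`, because `s = θ t`.
  have hid : ∀ i, lam i * (∑ j, q i j * (u i * (1 + θ * (w j / w i - 1))) - u i) +
      s * a i * u i = 0 := fun i => by
    have h := congrFun htw i
    rw [tiltedGenerator_mulVec, Pi.zero_apply] at h
    have hsum : ∑ j, q i j * (u i * (1 + θ * (w j / w i - 1))) =
        u i * ((1 - θ) + θ * ((q.mulVec w) i / w i)) := by
      have : ∀ j, q i j * (u i * (1 + θ * (w j / w i - 1))) =
          q i j * (u i * (1 - θ)) + q i j * w j * (u i * θ / w i) := fun j => by ring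
      simp only [this]
      rw [Finset.sum_add_distrib, ← Finset.sum_mul, ← Finset.sum_mul, hrow,
        show ∑ j, q i j * w j = (q.mulVec w) i from rfl]
      ring
    rw [hsum, hsθ]
    have hwi := (hw i).ne'
    field_simp
    linear_combination θ * u i * h
  have hBu : ∀ i, ((tiltedGenerator lam a q s).mulVec u) i ≤ 0 := fun i => by
    rw [tiltedGenerator_mulVec, ← hid i]
    have : (q.mulVec u) i ≤ ∑ j, q i j * (u i * (1 + θ * (w j / w i - 1))) :=
      Finset.sum_le_sum fun j _ => mul_le_mul_of_nonneg_left (hule i j) (hq_irr.nonneg i j)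
    have := mul_le_mul_of_nonneg_left this (hlam i).le
    linarith
  have hBu0 : (tiltedGenerator lam a q s).mulVec u = 0 := by
    -- Applied to `-u`, this makes `-c v` the largest multiple of `v` below `u`; the minimum
    -- principle then gives equality everywhere.
    obtain ⟨c, hc, i, hi⟩ := exists_touching_multiple (-u) hv
    have hz : u + c • v = 0 := by
      refine eq_zero_of_mulVec_nonpos (i := i) hq_irr
        (tiltedGenerator_nonneg_of_ne (a := a) hlam hq_irr.nonneg s)
        (tiltedGenerator_pos_of_ne hlam s) (fun j => ?_) ?_ fun j => ?_
      · have := hc j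
        simp only [Pi.neg_apply, Pi.add_apply, Pi.smul_apply, smul_eq_mul] at this ⊢
        linarith
      · simp only [Pi.neg_apply, Pi.add_apply, Pi.smul_apply, smul_eq_mul] at hi ⊢
        linarith
      · rw [Matrix.mulVec_add, Matrix.mulVec_smul, hsv, smul_zero, add_zero]
        exact hBu j
    rw [eq_neg_of_add_eq_zero_left hz, Matrix.mulVec_neg, Matrix.mulVec_smul, hsv, smul_zero,
      neg_zero]
  -- Equality in the row sum forces equality in each Bernoulli term with `q i j > 0`; strictness for
  -- `θ < 1` leaves only `w j = w i`.
  have hwconst : ∀ i j, 0 < q i j → w j = w i := fun i j hij => by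
    have hterm : ∀ k ∈ Finset.univ, 0 ≤ q i k * (u i * (1 + θ * (w k / w i - 1)) - u k) :=
      fun k _ => mul_nonneg (hq_irr.nonneg i k) (sub_nonneg.2 (hule i k))
    have hsum : ∑ k, q i k * (u i * (1 + θ * (w k / w i - 1)) - u k) = 0 := by
      have h1 := congrFun hBu0 i
      rw [tiltedGenerator_mulVec, Pi.zero_apply] at h1
      have h2 := hid i
      simp only [mul_sub (q i _), Finset.sum_sub_distrib]
      have h3 : lam i * (∑ k, q i k * (u i * (1 + θ * (w k / w i - 1))) - (q.mulVec u) i) = 0 := by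
        linarith
      exact (mul_eq_zero.1 h3).resolve_left (hlam i).ne'
    have h := (Finset.sum_eq_zero_iff_of_nonneg hterm).1 hsum j (Finset.mem_univ j)
    have h' := (mul_eq_zero.1 h).resolve_left hij.ne'
    by_contra hne
    have hlt := rpow_one_add_lt_one_add_mul_self (hxge i j)
      (s := w j / w i - 1) (fun h0 => hne ((div_eq_one_iff_eq (hw i).ne').1 (sub_eq_zero.1 h0)))
      hθ0 hθ1
    have := mul_lt_mul_of_pos_left hlt (hupos i)
    rw [← hx i j] at this
    linarith
  obtain ⟨i, hai⟩ := ha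
  have hall : ∀ j, w j = w i := fun j =>
    mem_of_isIrreducible hq_irr (S := {j | w j = w i}) rfl
      (fun k hk l hkl => (hwconst k l hkl).trans hk) j
  have h := congrFun htw i
  rw [tiltedGenerator_mulVec] at h
  have hqw : (q.mulVec w) i = w i := by
    simp only [Matrix.mulVec, dotProduct]
    simp only [hall, ← Finset.sum_mul, hrow, one_mul]
  rw [hqw, sub_self, mul_zero, zero_add, Pi.zero_apply] at h
  exact mul_ne_zero (mul_ne_zero ht.ne' hai) (hw i).ne' h

end Tilted

/-! ### The threshold at which a denominator of the jump matrix first vanishes -/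

section SOne

variable {E : Type*} [Finite E] {lam a : E → ℝ}

theorem exists_sOne_eq (ha : ∃ i, 0 < a i) : ∃ i, 0 < a i ∧ lam i / a i = sOne lam a := by
  have hne : ((fun i => lam i / a i) '' {i | 0 < a i}).Nonempty := Set.Nonempty.image _ ha
  obtain ⟨i, hi, h⟩ := hne.csInf_mem (Set.toFinite _)
  exact ⟨i, hi, h⟩

theorem sOne_pos (hlam : ∀ i, 0 < lam i) (ha : ∃ i, 0 < a i) : 0 < sOne lam a := by
  obtain ⟨i, hi, h⟩ := exists_sOne_eq (lam := lam) ha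
  exact h ▸ div_pos (hlam i) hi

theorem sub_mul_pos_of_lt_sOne (hlam : ∀ i, 0 < lam i) {s : ℝ} (hs : 0 < s)
    (h : s < sOne lam a) (i : E) : 0 < lam i - s * a i := by
  by_cases hai : 0 < a i
  · have : sOne lam a ≤ lam i / a i := csInf_le (Set.toFinite _).bddBelow ⟨i, hai, rfl⟩
    have := (lt_div_iff₀ hai).1 (h.trans_le this)
    linarith
  · have := mul_nonpos_of_nonneg_of_nonpos hs.le (not_lt.1 hai)
    linarith [hlam i]

end SOne

/-! ### The zero of the Perron eigenvalue -/

section CriticalParameter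

variable {E : Type*} [Fintype E] [DecidableEq E] {lam a : E → ℝ} {q : Matrix E E ℝ}

/-- There is exactly one positive parameter for which the tilted generator has a positive vector
in its kernel, and it is smaller than `sOne lam a`. -/
theorem exists_unique_pos_kernel [Nontrivial E] (hlam : ∀ i, 0 < lam i)
    (hq : q ∈ Matrix.rowStochastic ℝ E) (hq_irr : q.IsIrreducible) (hq_diag : ∀ i, q i i = 0)
    {μ : E → ℝ} (hμ1 : ∑ i, μ i = 1) (hμG : Matrix.vecMul μ (generator lam q) = 0)
    (hα : ∑ i, a i * μ i < 0) (ha : ∃ i, 0 < a i) :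
    ∃ κ ∈ Set.Ioo 0 (sOne lam a), ∀ s, 0 < s →
      ((∃ v : E → ℝ, (∀ i, 0 < v i) ∧ (tiltedGenerator lam a q s).mulVec v = 0) ↔ s = κ) := by
  have hoff := fun s => tiltedGenerator_nonneg_of_ne (a := a) hlam hq_irr.nonneg s
  choose r v hv hrv using fun s => exists_pos_eigenvector_of_offDiag hq_irr hq_diag
    (hoff s) (tiltedGenerator_pos_of_ne hlam s)
  -- Testing `B_s` on the Perron vector of `B_t` changes row `i` by `(s - t) a i` times the vector,
  -- so comparison makes `r` Lipschitz.
  have hcont : Continuous r := by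
    refine (LipschitzWith.of_le_add_mul (∑ i, ‖a i‖₊) fun s t => ?_).continuous
    refine le_of_mulVec_bounds (hoff s) (hv s) (hv t) (fun i => ?_) fun i => ?_
    · rw [hrv s]; rfl
    · have h := congrFun (hrv t) i
      rw [tiltedGenerator_mulVec, Pi.smul_apply, smul_eq_mul] at h
      have hai : |a i| ≤ ∑ k, |a k| :=
        Finset.single_le_sum (f := fun k => |a k|) (fun k _ => abs_nonneg _) (Finset.mem_univ i)
      have h1 : (s - t) * a i ≤ (∑ k, |a k|) * |s - t| := by
        calc (s - t) * a i ≤ |(s - t) * a i| := le_abs_self _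
          _ = |a i| * |s - t| := by rw [abs_mul, mul_comm]
          _ ≤ _ := mul_le_mul_of_nonneg_right hai (abs_nonneg _)
      have h2 := mul_le_mul_of_nonneg_right h1 (hv t i).le
      rw [tiltedGenerator_mulVec]
      simp only [NNReal.coe_sum, coe_nnnorm, Real.norm_eq_abs, Real.dist_eq]
      linarith
  have hpos : 0 < r (sOne lam a) := by
    obtain ⟨i, hai, hi⟩ := exists_sOne_eq (lam := lam) ha
    have h := congrFun (hrv (sOne lam a)) i
    rw [tiltedGenerator_mulVec, Pi.smul_apply, smul_eq_mul] at h
    obtain ⟨j, hj⟩ := hq_irr.exists_pos i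
    have hqv : 0 < (q.mulVec (v (sOne lam a))) i :=
      Finset.sum_pos' (fun k _ => mul_nonneg (hq_irr.nonneg i k) (hv _ k).le)
        ⟨j, Finset.mem_univ j, mul_pos hj (hv _ j)⟩
    -- In the row attaining the minimum the diagonal terms cancel, leaving only the positive jump
    -- term.
    have hl : sOne lam a * a i = lam i := by rw [← hi, div_mul_cancel₀ _ hai.ne']
    rw [hl] at h
    have h' : 0 < r (sOne lam a) * v (sOne lam a) i := by
      rw [← h]
      linarith [mul_pos (hlam i) hqv]
    exact pos_of_mul_pos_left h' (hv _ i).le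
  have hs1 := sOne_pos hlam ha
  obtain ⟨ε, hε0, hε1, hrε⟩ : ∃ ε, 0 < ε ∧ ε < sOne lam a ∧ r ε < 0 := by
    set α := ∑ i, a i * μ i with hαdef
    -- With `G h = α - a`, the test vector `1 + ε h` satisfies `B_ε (1 + ε h) = ε (α + ε a h)`: the
    -- perturbation has averaged `a` to `α` at first order.
    obtain ⟨h, hh⟩ := exists_generator_mulVec_eq (f := fun i => α - a i) hlam hq hq_irr hμ1 hμG
      (by simp only [dotProduct, mul_sub, Finset.sum_sub_distrib, ← Finset.sum_mul, hμ1, one_mul,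
            hαdef, mul_comm, sub_self])
    have hev : ∀ (b c d : ℝ), c < d → ∀ᶠ s in 𝓝[>] (0 : ℝ), c + s * b < d := fun b c d hcd => by
      have : Tendsto (fun s : ℝ => c + s * b) (𝓝[>] 0) (𝓝 (c + 0 * b)) :=
        (Continuous.tendsto (by fun_prop) 0).mono_left nhdsWithin_le_nhds
      exact this.eventually_lt_const (by simpa using hcd)
    have hevall : ∀ᶠ s in 𝓝[>] (0 : ℝ), s < sOne lam a ∧ (∀ i, 1 + s * h i < 2) ∧
        (∀ i, -1 + s * (-h i) < 0) ∧ ∀ i, α + s * (a i * h i) < α / 2 := by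
      refine Filter.Eventually.and ?_ (Filter.Eventually.and ?_ (Filter.Eventually.and ?_ ?_))
      · simpa using hev 1 0 _ hs1
      · exact eventually_all.2 fun i => hev _ _ _ (by norm_num)
      · exact eventually_all.2 fun i => hev _ _ _ (by norm_num)
      · exact eventually_all.2 fun i => hev _ _ _ (by linarith)
    obtain ⟨ε, ⟨hε1, hu2, hu0, hα2⟩, hε0⟩ := (hevall.and self_mem_nhdsWithin).exists
    have hε0' : 0 < ε := hε0
    refine ⟨ε, hε0', hε1, ?_⟩
    -- The right side is below `ε α / 2`; since `α < 0` and `1 + ε h < 2`, this is at most `(ε α /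
    -- 4) (1 + ε h)`.
    have hrle : r ε ≤ ε * α / 4 := by
      refine le_of_mulVec_bounds (hoff ε) (hv ε) (w := fun i => 1 + ε * h i)
        (fun i => by linarith [hu0 i]) (fun i => by rw [hrv]; rfl) fun i => ?_
      have hGh : lam i * ((q.mulVec h) i - h i) = α - a i := by
        have h0 := tiltedGenerator_mulVec (lam := lam) (a := a) (q := q) 0 h i
        rw [tiltedGenerator] at h0
        simp only [zero_mul, Matrix.diagonal_zero, add_zero, hh] at h0
        exact h0.symm
      have hqu : (q.mulVec fun i => 1 + ε * h i) i = 1 + ε * (q.mulVec h) i := by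
        have : (fun i => 1 + ε * h i) = (1 : E → ℝ) + ε • h := rfl
        rw [this, Matrix.mulVec_add, Matrix.one_vecMul_of_mem_rowStochastic hq,
          Matrix.mulVec_smul]
        rfl
      rw [tiltedGenerator_mulVec, hqu]
      have e1 : lam i * (1 + ε * (q.mulVec h) i - (1 + ε * h i)) + ε * a i * (1 + ε * h i) =
          ε * (α + ε * (a i * h i)) := by linear_combination ε * hGh
      rw [e1]
      have e2 := mul_lt_mul_of_pos_left (hα2 i) hε0'
      have e3 := mul_le_mul_of_nonpos_left (hu2 i).le (mul_neg_of_pos_of_neg hε0' hα).le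
      linarith
    linarith [mul_neg_of_pos_of_neg hε0' hα]
  obtain ⟨κ, ⟨hκ0, hκ1⟩, hκ⟩ :=
    intermediate_value_Icc hε1.le hcont.continuousOn (show (0 : ℝ) ∈ Set.Icc _ _ from
      ⟨hrε.le, hpos.le⟩)
  have hκpos : 0 < κ := hε0.trans_le hκ0
  have hκker : (tiltedGenerator lam a q κ).mulVec (v κ) = 0 := by rw [hrv, hκ, zero_smul]
  refine ⟨κ, ⟨hκpos, lt_of_le_of_ne hκ1 ?_⟩, fun s hs => ⟨?_, ?_⟩⟩
  · rintro rfl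
    exact hpos.ne' hκ
  · rintro ⟨w, hw, hsw⟩
    have ha' : ∃ i, a i ≠ 0 := ha.imp fun i hi => hi.ne'
    exact le_antisymm
      (not_lt.1 (not_lt_of_pos_kernel hlam hq hq_irr ha' hκpos (hv κ) hw hκker hsw))
      (not_lt.1 (not_lt_of_pos_kernel hlam hq hq_irr ha' hs hw (hv κ) hsw hκker))
  · rintro rfl
    exact ⟨v s, hv s, hκker⟩

theorem matM_mulVec_eq_self_iff {s : ℝ} (hs : ∀ i, 0 < lam i - s * a i) (v : E → ℝ) :
    (matM lam a q s).mulVec v = v ↔ (tiltedGenerator lam a q s).mulVec v = 0 := by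
  rw [funext_iff, funext_iff]
  refine forall_congr' fun i => ?_
  have hM : ((matM lam a q s).mulVec v) i = lam i * (q.mulVec v) i / (lam i - s * a i) := by
    simp only [matM, Matrix.mulVec, dotProduct, Matrix.of_apply, Finset.mul_sum, Finset.sum_div]
    exact Finset.sum_congr rfl fun j _ => by ring
  rw [hM, tiltedGenerator_mulVec, Pi.zero_apply, div_eq_iff (hs i).ne']
  constructor <;> intro h <;> linarith

theorem rho_matM_eq_one_iff [Nonempty E] (hlam : ∀ i, 0 < lam i) (hq_irr : q.IsIrreducible) {s : ℝ}
    (hs : ∀ i, 0 < lam i - s * a i) :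
    rho (matM lam a q s) = 1 ↔
      ∃ v : E → ℝ, (∀ i, 0 < v i) ∧ (tiltedGenerator lam a q s).mulVec v = 0 := by
  have hnn : ∀ i j, 0 ≤ matM lam a q s i j := fun i j =>
    mul_nonneg (hq_irr.nonneg i j) (div_pos (hlam i) (hs i)).le
  simp only [← matM_mulVec_eq_self_iff hs]
  constructor
  · intro h
    obtain ⟨r, v, hv, hr⟩ := exists_pos_eigenvector (A := matM lam a q s)
      (isIrreducible_of_pos_imp_pos hq_irr hnn fun i j hij =>
        mul_pos hij (div_pos (hlam i) (hs i)))
    rw [rho_eq_of_pos_eigenvector hnn hv hr, ENNReal.ofReal_eq_one] at h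
    exact ⟨v, hv, by rw [hr, h, one_smul]⟩
  · rintro ⟨v, hv, h⟩
    rw [rho_eq_of_pos_eigenvector hnn hv (r := 1) (by rw [h, one_smul]), ENNReal.ofReal_one]

end CriticalParameter

/-! ### The Lie–Trotter product formula in a Banach algebra -/

section Trotter

variable {𝔸 : Type*} [NormedRing 𝔸] [NormOneClass 𝔸]

/-- Telescoping the difference of powers; `c ≥ 1` allows the crude exponent `n` in place of `n - 1`.
-/
theorem norm_pow_sub_pow_le {x y : 𝔸} {c : ℝ} (hc : 1 ≤ c) (hx : ‖x‖ ≤ c) (hy : ‖y‖ ≤ c)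
    (n : ℕ) : ‖x ^ n - y ^ n‖ ≤ n * c ^ n * ‖x - y‖ := by
  induction n with
  | zero => simp
  | succ n ih =>
    have hc0 : 0 ≤ c := zero_le_one.trans hc
    have e : x ^ (n + 1) - y ^ (n + 1) = x * (x ^ n - y ^ n) + (x - y) * y ^ n := by
      rw [pow_succ', pow_succ']; noncomm_ring
    have h1 : ‖x * (x ^ n - y ^ n)‖ ≤ c * (n * c ^ n * ‖x - y‖) :=
      (norm_mul_le _ _).trans (mul_le_mul hx ih (norm_nonneg _) hc0)
    have h2 : ‖(x - y) * y ^ n‖ ≤ ‖x - y‖ * c ^ (n + 1) := by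
      refine (norm_mul_le _ _).trans (mul_le_mul_of_nonneg_left ?_ (norm_nonneg _))
      exact (norm_pow_le _ _).trans
        ((pow_le_pow_left₀ (norm_nonneg _) hy n).trans (pow_le_pow_right₀ hc n.le_succ))
    rw [e]
    refine (norm_add_le _ _).trans ((add_le_add h1 h2).trans (le_of_eq ?_))
    push_cast
    ring

variable [NormedAlgebra ℝ 𝔸] [CompleteSpace 𝔸]

theorem norm_exp_le_exp_norm (x : 𝔸) : ‖NormedSpace.exp x‖ ≤ Real.exp ‖x‖ := by
  have h1 := NormedSpace.exp_series_hasSum_exp' (𝕂 := ℝ) x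
  have h2 : HasSum (fun n : ℕ => ‖x‖ ^ n / (n.factorial : ℝ)) (Real.exp ‖x‖) := by
    rw [Real.exp_eq_exp_ℝ]
    exact NormedSpace.expSeries_div_hasSum_exp ‖x‖
  rw [← h1.tsum_eq]
  refine tsum_of_norm_bounded h2 fun n => ?_
  rw [norm_smul, norm_inv, div_eq_inv_mul, Real.norm_natCast]
  exact mul_le_mul_of_nonneg_left (norm_pow_le x n) (by positivity)

/-- **Lie–Trotter product formula**. -/
theorem tendsto_exp_mul_exp_pow (x y : 𝔸) :
    Tendsto (fun n : ℕ => (NormedSpace.exp ((n : ℝ)⁻¹ • x) * NormedSpace.exp ((n : ℝ)⁻¹ • y)) ^ n)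
      atTop (𝓝 (NormedSpace.exp (x + y))) := by
  let f : ℝ → 𝔸 := fun h => NormedSpace.exp (h • x) * NormedSpace.exp (h • y)
  let g : ℝ → 𝔸 := fun h => NormedSpace.exp (h • (x + y))
  -- The two curves agree to first order at `0`, so they differ by `o(1/n)` at `1/n`, which beats
  -- the factor `n` lost in comparing powers.
  have hfg : HasDerivAt (fun h => f h - g h) 0 0 := by
    have hf := (hasDerivAt_exp_smul_const (𝕂 := ℝ) x 0).mul
      (hasDerivAt_exp_smul_const (𝕂 := ℝ) y 0)
    have hg := hasDerivAt_exp_smul_const (𝕂 := ℝ) (x + y) 0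
    exact (hf.sub hg).congr_deriv (by simp [NormedSpace.exp_zero])
  have hlim : Tendsto (fun n : ℕ => (n : ℝ) * ‖f (n : ℝ)⁻¹ - g (n : ℝ)⁻¹‖) atTop (𝓝 0) := by
    have h0 : f 0 - g 0 = 0 := by simp [f, g, NormedSpace.exp_zero]
    have ho := hasDerivAt_iff_isLittleO.1 hfg
    simp only [h0, sub_zero, smul_zero] at ho
    have hn : Tendsto (fun n : ℕ => (n : ℝ)⁻¹) atTop (𝓝 0) := tendsto_inv_atTop_nhds_zero_nat
    have := ((ho.comp_tendsto hn).norm_left).tendsto_div_nhds_zero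
    simpa [Function.comp_def, div_inv_eq_mul, mul_comm] using this
  set K := ‖x‖ + ‖y‖ with hK
  have hdiff : Tendsto (fun n : ℕ => f (n : ℝ)⁻¹ ^ n - g (n : ℝ)⁻¹ ^ n) atTop (𝓝 0) := by
    refine squeeze_zero_norm' (a := fun n : ℕ => Real.exp K * (n * ‖f (n : ℝ)⁻¹ - g (n : ℝ)⁻¹‖))
      ?_ (by simpa using hlim.const_mul (Real.exp K))
    filter_upwards [eventually_gt_atTop 0] with n hn
    have hn' : (0 : ℝ) < n := Nat.cast_pos.2 hn
    have hinv : ‖(n : ℝ)⁻¹‖ = (n : ℝ)⁻¹ := Real.norm_of_nonneg (inv_nonneg.2 hn'.le)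
    have hc : Real.exp ((n : ℝ)⁻¹ * K) ^ n = Real.exp K := by
      rw [← Real.exp_nat_mul, mul_inv_cancel_left₀ hn'.ne']
    refine (norm_pow_sub_pow_le (c := Real.exp ((n : ℝ)⁻¹ * K)) ?_ ?_ ?_ n).trans (le_of_eq ?_)
    · exact Real.one_le_exp (by positivity)
    · refine (norm_mul_le _ _).trans ((mul_le_mul (norm_exp_le_exp_norm _)
        (norm_exp_le_exp_norm _) (norm_nonneg _) (Real.exp_nonneg _)).trans (le_of_eq ?_))
      rw [← Real.exp_add, norm_smul, norm_smul, hinv, hK, mul_add]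
    · refine (norm_exp_le_exp_norm _).trans (Real.exp_le_exp.2 ?_)
      rw [norm_smul, hinv]
      exact mul_le_mul_of_nonneg_left (norm_add_le x y) (inv_nonneg.2 hn'.le)
    · rw [hc]; ring
  have hg : ∀ᶠ n : ℕ in atTop, f (n : ℝ)⁻¹ ^ n = (f (n : ℝ)⁻¹ ^ n - g (n : ℝ)⁻¹ ^ n) +
      NormedSpace.exp (x + y) := by
    filter_upwards [eventually_gt_atTop 0] with n hn
    have hn' : (n : ℝ) ≠ 0 := (Nat.cast_pos.2 hn).ne'
    have : g (n : ℝ)⁻¹ ^ n = NormedSpace.exp (x + y) := by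
      let _ : NormedAlgebra ℚ 𝔸 := NormedAlgebra.restrictScalars ℚ ℝ 𝔸
      simp only [g]
      rw [← NormedSpace.exp_nsmul, ← Nat.cast_smul_eq_nsmul ℝ, smul_smul, mul_inv_cancel₀ hn',
        one_smul]
    rw [this, sub_add_cancel]
  refine Tendsto.congr' (hg.mono fun n h => h.symm) ?_
  simpa using hdiff.add_const (NormedSpace.exp (x + y))

end Trotter

/-! ### Matrix exponentials: product formula, derivative, eigenvectors -/

section MatrixExp

variable {E : Type*} [Fintype E] [DecidableEq E]

open scoped Matrix.Norms.Operator

theorem tendsto_matrix_exp_mul_exp_pow [Nonempty E] (A B : Matrix E E ℝ) :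
    Tendsto (fun n : ℕ => (NormedSpace.exp ((n : ℝ)⁻¹ • A) * NormedSpace.exp ((n : ℝ)⁻¹ • B)) ^ n)
      atTop (𝓝 (NormedSpace.exp (A + B))) :=
  tendsto_exp_mul_exp_pow A B

theorem hasDerivAt_matrix_exp_smul (A : Matrix E E ℝ) (i j : E) :
    HasDerivAt (fun t : ℝ => NormedSpace.exp (t • A) i j) (A i j) 0 := by
  have h := hasDerivAt_exp_smul_const (𝕂 := ℝ) A 0
  rw [zero_smul, NormedSpace.exp_zero, one_mul] at h
  exact hasDerivAt_pi.1 (hasDerivAt_pi.1 h i) j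

theorem matrix_exp_mulVec_of_eigenvector {A : Matrix E E ℝ} {v : E → ℝ} {c : ℝ}
    (h : A.mulVec v = c • v) : (NormedSpace.exp A).mulVec v = Real.exp c • v := by
  have hpow : ∀ k : ℕ, (A ^ k).mulVec v = c ^ k • v := fun k => by
    induction k with
    | zero => simp
    | succ k ih => rw [pow_succ, ← Matrix.mulVec_mulVec, h, Matrix.mulVec_smul, ih, smul_smul,
        pow_succ, mul_comm]
  have h1 := (NormedSpace.exp_series_hasSum_exp' (𝕂 := ℝ) A).map
    ({ toFun := fun M : Matrix E E ℝ => M.mulVec v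
       map_zero' := Matrix.zero_mulVec v
       map_add' := fun M N => Matrix.add_mulVec M N v } : Matrix E E ℝ →+ (E → ℝ))
    (Continuous.matrix_mulVec continuous_id continuous_const)
  have h2 : HasSum (fun n : ℕ => c ^ n / (n.factorial : ℝ)) (Real.exp c) := by
    rw [Real.exp_eq_exp_ℝ]
    exact NormedSpace.expSeries_div_hasSum_exp c
  refine h1.unique ?_
  convert h2.smul_const v using 1
  funext n
  simp only [Function.comp_apply, AddMonoidHom.coe_mk, ZeroHom.coe_mk, Matrix.smul_mulVec, hpow,
    smul_smul]
  rw [div_eq_inv_mul]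

end MatrixExp

/-! ### Riemann sums along right-continuous step paths -/

section RiemannSum

/-- The right Riemann sums of a bounded function with locally constant right germs converge to
its integral. -/
theorem tendsto_sum_mul_of_right_continuous {g : ℝ≥0 → ℝ} {C : ℝ} (hC : ∀ u, |g u| ≤ C)
    (hg : ∀ t, ∀ᶠ u in 𝓝[≥] t, g u = g t) (δ : ℝ≥0) (hδ : 0 < δ) :
    Tendsto (fun n : ℕ => ∑ k ∈ Finset.range n, (δ / n : ℝ) * g ((k + 1 : ℕ) * (δ / n)))
      atTop (𝓝 (∫ u in (0 : ℝ)..δ, g u.toNNReal)) := by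
  -- Rounding up samples `g` at the right end of the grid cell containing `u`, so the sample points
  -- approach `u` from the side on which `g` is locally constant.
  let F : ℕ → ℝ → ℝ := fun n u => g ((⌈u / (δ / n : ℝ)⌉₊ : ℕ) * (δ / n))
  have hmeas : ∀ n, Measurable (F n) := fun n => by
    have h1 : Measurable fun u : ℝ => ⌈u / (δ / n : ℝ)⌉₊ :=
      Nat.measurable_ceil.comp (measurable_id.div_const _)
    exact (measurable_from_nat (f := fun m : ℕ => g (m * (δ / n)))).comp h1
  have hint : ∀ n (b c : ℝ), IntervalIntegrable (F n) volume b c := fun n b c =>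
    (intervalIntegrable_const (c := C)).mono_fun (hmeas n).aestronglyMeasurable
      (Eventually.of_forall fun u => (hC _).trans (le_abs_self C))
  have hF : ∀ᶠ n : ℕ in atTop, ∫ u in (0 : ℝ)..δ, F n u =
      ∑ k ∈ Finset.range n, (δ / n : ℝ) * g ((k + 1 : ℕ) * (δ / n)) := by
    filter_upwards [eventually_gt_atTop 0] with n hn
    have hn' : (0 : ℝ) < n := Nat.cast_pos.2 hn
    have hh : (0 : ℝ) < δ / n := div_pos hδ hn'
    have hsplit := intervalIntegral.sum_integral_adjacent_intervals (f := F n) (μ := volume)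
      (a := fun k : ℕ => (k : ℝ) * (δ / n)) (n := n) fun k _ => hint n _ _
    simp only [Nat.cast_zero, zero_mul, mul_div_cancel₀ (δ : ℝ) hn'.ne'] at hsplit
    rw [← hsplit]
    refine Finset.sum_congr rfl fun k _ => ?_
    have hle : (k : ℝ) * (δ / n) ≤ ((k + 1 : ℕ) : ℝ) * (δ / n) := by
      push_cast; nlinarith
    rw [intervalIntegral.integral_of_le hle]
    have hcongr : Set.EqOn (F n) (fun _ => g ((k + 1 : ℕ) * (δ / n)))
        (Set.Ioc ((k : ℝ) * (δ / n)) (((k + 1 : ℕ) : ℝ) * (δ / n))) := fun u hu => by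
      have : ⌈u / (δ / n : ℝ)⌉₊ = k + 1 := by
        rw [Nat.ceil_eq_iff (Nat.succ_ne_zero k)]
        exact ⟨(lt_div_iff₀ hh).2 (by simpa using hu.1), (div_le_iff₀ hh).2 hu.2⟩
      simp only [F, this]
    rw [setIntegral_congr_fun measurableSet_Ioc hcongr, setIntegral_const, Real.volume_real_Ioc,
      smul_eq_mul]
    congr 1
    rw [max_eq_left (by linarith)]
    push_cast
    ring
  refine Tendsto.congr' hF ?_
  refine intervalIntegral.tendsto_integral_filter_of_dominated_convergence (fun _ => C)
    (Eventually.of_forall fun n => (hmeas n).aestronglyMeasurable)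
    (Eventually.of_forall fun n => Eventually.of_forall fun u _ => hC _)
    intervalIntegrable_const (Eventually.of_forall fun u hu => ?_)
  have hu0 : 0 < u := by
    rw [Set.uIoc_of_le (NNReal.coe_nonneg δ)] at hu
    exact hu.1
  have hh0 : Tendsto (fun n : ℕ => (δ / n : ℝ)) atTop (𝓝 0) :=
    tendsto_const_div_atTop_nhds_zero_nat _
  have hlow : ∀ᶠ n : ℕ in atTop, u ≤ (⌈u / (δ / n : ℝ)⌉₊ : ℕ) * (δ / n : ℝ) := by
    filter_upwards [eventually_gt_atTop 0] with n hn
    have hh : (0 : ℝ) < δ / n := div_pos hδ (Nat.cast_pos.2 hn)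
    exact (div_le_iff₀ hh).1 (Nat.le_ceil _)
  have hup : ∀ᶠ n : ℕ in atTop, (⌈u / (δ / n : ℝ)⌉₊ : ℕ) * (δ / n : ℝ) ≤ u + δ / n := by
    filter_upwards [eventually_gt_atTop 0] with n hn
    have hh : (0 : ℝ) < δ / n := div_pos hδ (Nat.cast_pos.2 hn)
    have := mul_le_mul_of_nonneg_right (Nat.ceil_lt_add_one (div_nonneg hu0.le hh.le)).le hh.le
    rwa [add_mul, one_mul, div_mul_cancel₀ _ hh.ne'] at this
  have hreal : Tendsto (fun n : ℕ => (⌈u / (δ / n : ℝ)⌉₊ : ℕ) * (δ / n : ℝ)) atTop (𝓝 u) :=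
    tendsto_of_tendsto_of_tendsto_of_le_of_le' tendsto_const_nhds
      (by simpa using hh0.const_add u) hlow hup
  have hnn : Tendsto (fun n : ℕ => ((⌈u / (δ / n : ℝ)⌉₊ : ℕ) * (δ / n) : ℝ≥0)) atTop
      (𝓝[≥] u.toNNReal) := by
    refine tendsto_nhdsWithin_iff.2 ⟨?_, ?_⟩
    · rw [← NNReal.tendsto_coe, Real.coe_toNNReal u hu0.le]
      simpa using hreal
    · filter_upwards [hlow] with n hn
      exact Real.toNNReal_le_iff_le_coe.2 (by simpa using hn)
  exact tendsto_const_nhds.congr' ((hnn.eventually (hg u.toNNReal)).mono fun n h => h.symm)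

end RiemannSum

/-! ### Matrix powers as path sums -/

section Paths

variable {E : Type*} [Fintype E] [DecidableEq E]

/-- The entries of a matrix power as sums over paths. -/
theorem pow_apply_eq_sum_paths (Q : Matrix E E ℝ) (n : ℕ) (i j : E) :
    (Q ^ n) i j = ∑ x : Fin (n + 1) → E, if x 0 = i ∧ x (Fin.last n) = j then
      ∏ k : Fin n, Q (x k.castSucc) (x k.succ) else 0 := by
  induction n generalizing i with
  | zero =>
    rw [← (Equiv.funUnique (Fin 1) E).symm.sum_comp]
    simp only [pow_zero, Matrix.one_apply, Finset.univ_eq_empty, Finset.prod_empty]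
    change _ = ∑ y : E, if y = i ∧ y = j then (1 : ℝ) else 0
    rw [Finset.sum_eq_single i (fun y _ hy => if_neg fun h => hy h.1) (by simp)]
    simp
  | succ n ih =>
    rw [pow_succ', Matrix.mul_apply, ← (Fin.consEquiv fun _ => E).sum_comp, Fintype.sum_prod_type]
    simp only [ih, Finset.mul_sum, Fin.consEquiv_apply, Fin.cons_zero, Fin.prod_univ_succ,
      ← Fin.succ_last, Fin.cons_succ, Fin.castSucc_zero, ← Fin.succ_castSucc]
    rw [Finset.sum_comm, Finset.sum_comm (s := (Finset.univ : Finset E))]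
    refine Finset.sum_congr rfl fun y _ => ?_
    rw [Finset.sum_eq_single (y 0) (fun k _ hk => by simp [Ne.symm hk]) (by simp),
      Finset.sum_eq_single i (fun k _ hk => by simp [hk]) (by simp)]
    simp

end Paths

/-! ### The Feynman–Kac formula and its spectral consequences -/

section FeynmanKac

variable {E : Type*} [Fintype E] [DecidableEq E] {Ω : Type*} [MeasurableSpace Ω]
  {lam a : E → ℝ} {q : Matrix E E ℝ} {P : E → Measure Ω} {X : ℝ≥0 → Ω → E}

theorem IsMarkovJumpProcess.ae_eq (hX : IsMarkovJumpProcess lam q P X) (i : E) :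
    ∀ᵐ ω ∂P i, X 0 ω = i := by
  have := hX.isProbabilityMeasure i
  have h := hX.finite_dim 0 (fun _ => 0) (fun _ => i) monotone_const rfl
  refine (mem_ae_iff_prob_eq_one (hX.measurableSet_eq 0 i)).2 ?_
  simpa [measureReal_def, ENNReal.toReal_eq_one_iff] using h

theorem IsMarkovJumpProcess.measurableSet_path (hX : IsMarkovJumpProcess lam q P X) {n : ℕ}
    (t : Fin (n + 1) → ℝ≥0) (x : Fin (n + 1) → E) :
    MeasurableSet {ω | ∀ k, X (t k) ω = x k} := by
  rw [Set.ofPred_forall]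
  exact MeasurableSet.iInter fun k => hX.measurableSet_eq (t k) (x k)

theorem IsMarkovJumpProcess.real_path (hX : IsMarkovJumpProcess lam q P X) (i : E) {n : ℕ}
    {t : Fin (n + 1) → ℝ≥0} (ht : Monotone t) (ht0 : t 0 = 0) (x : Fin (n + 1) → E) :
    (P i).real {ω | ∀ k, X (t k) ω = x k} = if x 0 = i then
      ∏ k : Fin n, transition lam q (t k.succ - t k.castSucc) (x k.castSucc) (x k.succ) else 0 := by
  split_ifs with h
  · rw [← h]
    exact hX.finite_dim n t x ht ht0
  · have hnull : P i {ω | ∀ k, X (t k) ω = x k} = 0 := by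
      refine measure_mono_null (fun ω hω => ?_) (ae_iff.1 (hX.ae_eq i))
      intro h0
      have := hω 0
      rw [ht0] at this
      exact h (this.symm.trans h0)
    rw [measureReal_def, hnull, ENNReal.toReal_zero]

/-- A functional of the states at finitely many times takes finitely many values, so it is a finite
combination of indicators of path events. -/
theorem IsMarkovJumpProcess.integral_path (hX : IsMarkovJumpProcess lam q P X) (i : E) {n : ℕ}
    {t : Fin (n + 1) → ℝ≥0} (ht : Monotone t) (ht0 : t 0 = 0) (W : (Fin (n + 1) → E) → ℝ) :
    ∫ ω, W (fun k => X (t k) ω) ∂P i = ∑ x : Fin (n + 1) → E, W x * if x 0 = i then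
      ∏ k : Fin n, transition lam q (t k.succ - t k.castSucc) (x k.castSucc) (x k.succ) else 0 := by
  have := hX.isProbabilityMeasure i
  have hW : ∀ ω, W (fun k => X (t k) ω) = ∑ x : Fin (n + 1) → E,
      W x * {ω | ∀ k, X (t k) ω = x k}.indicator 1 ω := fun ω => by
    rw [Finset.sum_eq_single fun k => X (t k) ω]
    · simp
    · intro x _ hx
      rw [Set.indicator_of_notMem, mul_zero]
      exact fun h => hx (funext fun k => (h k).symm)
    · simp
  simp only [hW]
  rw [integral_finsetSum]
  · refine Finset.sum_congr rfl fun x _ => ?_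
    rw [integral_const_mul, integral_indicator_one (hX.measurableSet_path t x),
      hX.real_path i ht ht0 x]
  · exact fun x _ => ((integrable_const (1 : ℝ)).indicator (hX.measurableSet_path t x)).const_mul _

/-- The discretised Feynman–Kac formula on a regular grid. -/
theorem IsMarkovJumpProcess.integral_grid (hX : IsMarkovJumpProcess lam q P X) (i j : E) (n : ℕ)
    (h : ℝ≥0) (b : E → ℝ) :
    ∫ ω, Real.exp (∑ k : Fin n, b (X ((k + 1 : ℕ) * h) ω)) * (if X (n * h) ω = j then 1 else 0)
      ∂P i = ((transition lam q h * Matrix.diagonal fun k => Real.exp (b k)) ^ n) i j := by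
  let t : Fin (n + 1) → ℝ≥0 := fun k => (k : ℕ) * h
  have ht : Monotone t := fun k l hkl =>
    mul_le_mul_of_nonneg_right (Nat.cast_le.2 hkl) h.2
  have ht0 : t 0 = 0 := by simp [t]
  have hstep : ∀ k : Fin n, t k.succ - t k.castSucc = h := fun k => by
    simp [t, add_mul]
  have hint := hX.integral_path i ht ht0 fun x =>
    Real.exp (∑ k : Fin n, b (x k.succ)) * if x (Fin.last n) = j then 1 else 0
  simp only [hstep] at hint
  simp only [t, Fin.val_succ, Fin.val_last] at hint
  rw [hint, pow_apply_eq_sum_paths]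
  refine Finset.sum_congr rfl fun x _ => ?_
  by_cases h0 : x 0 = i <;> by_cases h1 : x (Fin.last n) = j <;>
    simp [h0, h1, Matrix.mul_diagonal, Finset.prod_mul_distrib, Real.exp_sum, mul_comm]

/-- **Feynman–Kac formula** for the jump process: the matrices `A_{(s,δ)}` form the semigroup
generated by `G + s diag a`. -/
theorem IsMarkovJumpProcess.matA_eq_exp [Nonempty E] (hX : IsMarkovJumpProcess lam q P X) (s : ℝ)
    (δ : ℝ≥0) (hδ : 0 < δ) :
    matA a P X s δ = NormedSpace.exp ((δ : ℝ) • tiltedGenerator lam a q s) := by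
  ext i j
  have := hX.isProbabilityMeasure i
  set C := ∑ k, |a k| with hCdef
  have hC : ∀ k, |a k| ≤ C := fun k =>
    Finset.single_le_sum (f := fun k => |a k|) (fun k _ => abs_nonneg _) (Finset.mem_univ k)
  have hCnn : 0 ≤ C := Finset.sum_nonneg fun k _ => abs_nonneg _
  -- Discretised weights: their expectations are entries of Trotter products by `integral_grid`,
  -- while pathwise they converge to the Feynman–Kac weight under a uniform bound. For `n = 0` the
  -- indicator reads `X 0`, which does not affect the limit.
  let F : ℕ → Ω → ℝ := fun n ω =>
    Real.exp (∑ k : Fin n, s * (δ / n) * a (X ((k + 1 : ℕ) * (δ / n)) ω)) *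
      (if X (n * (δ / n)) ω = j then 1 else 0)
  have hmeasX : ∀ (f : E → ℝ) (t : ℝ≥0), Measurable fun ω => f (X t ω) := fun f t => by
    let _ : MeasurableSpace E := ⊤
    have hXt : Measurable (X t) := measurable_to_countable' fun k => hX.measurableSet_eq t k
    exact (measurable_from_top (f := f)).comp hXt
  have hFmeas : ∀ n, AEStronglyMeasurable (F n) (P i) := fun n => by
    refine (Measurable.mul (Real.measurable_exp.comp (Finset.measurable_fun_sum _ fun k _ => ?_))
      ?_).aestronglyMeasurable
    · exact (hmeasX a _).const_mul _
    · exact hmeasX (fun k => if k = j then 1 else 0) _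
  have hFbound : ∀ n ω, ‖F n ω‖ ≤ Real.exp (|s| * δ * C) := fun n ω => by
    have h1 : ∑ k : Fin n, s * (δ / n) * a (X ((k + 1 : ℕ) * (δ / n)) ω) ≤ |s| * δ * C := by
      rcases Nat.eq_zero_or_pos n with rfl | hn
      · simp only [Finset.univ_eq_empty, Finset.sum_empty]
        positivity
      have hn' : (0 : ℝ) < n := Nat.cast_pos.2 hn
      calc ∑ k : Fin n, s * (δ / n : ℝ) * a (X ((k + 1 : ℕ) * (δ / n)) ω)
          ≤ ∑ k : Fin n, |s| * (δ / n) * C := by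
            refine Finset.sum_le_sum fun k _ => (le_abs_self _).trans ?_
            rw [abs_mul, abs_mul, abs_of_nonneg (by positivity : (0 : ℝ) ≤ δ / n)]
            exact mul_le_mul_of_nonneg_left (hC _) (by positivity)
        _ = |s| * δ * C := by
            rw [Finset.sum_const, Finset.card_univ, Fintype.card_fin, nsmul_eq_mul]
            field_simp
    have h2 : ‖(if X (n * (δ / n)) ω = j then 1 else 0 : ℝ)‖ ≤ 1 := by split_ifs <;> simp
    rw [norm_mul, Real.norm_of_nonneg (Real.exp_nonneg _)]
    exact (mul_le_of_le_one_right (Real.exp_nonneg _) h2).trans (Real.exp_le_exp.2 h1)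
  have hFlim : ∀ ω, Tendsto (fun n => F n ω) atTop
      (𝓝 (Phi a X δ ω ^ s * (if X δ ω = j then 1 else 0))) := fun ω => by
    have hR := tendsto_sum_mul_of_right_continuous (g := fun u => a (X u ω)) (fun u => hC _)
      (fun t => (hX.right_continuous ω t).mono fun u hu => congrArg a hu) δ hδ
    have hE := ((Real.continuous_exp.tendsto _).comp (hR.mul_const s)).mul_const
      (if X δ ω = j then (1 : ℝ) else 0)
    rw [Phi, ← Real.exp_mul]
    refine hE.congr' ?_
    filter_upwards [eventually_gt_atTop 0] with n hn
    have hn' : (n : ℝ≥0) ≠ 0 := (Nat.cast_pos.2 hn).ne'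
    simp only [F, Function.comp_apply, mul_div_cancel₀ δ hn']
    rw [Finset.sum_range, Finset.sum_mul]
    congr 2
    exact Finset.sum_congr rfl fun k _ => by ring
  have hlim1 : Tendsto (fun n => ∫ ω, F n ω ∂P i) atTop (𝓝 (matA a P X s δ i j)) :=
    tendsto_integral_of_dominated_convergence (fun _ => Real.exp (|s| * δ * C)) hFmeas
      (integrable_const _) (fun n => Eventually.of_forall (hFbound n))
      (Eventually.of_forall hFlim)
  have hlim2 := tendsto_matrix_exp_mul_exp_pow ((δ : ℝ) • generator lam q)
    ((δ : ℝ) • Matrix.diagonal fun k => s * a k)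
  rw [← smul_add] at hlim2
  refine tendsto_nhds_unique hlim1 ?_
  refine ((tendsto_pi_nhds.1 (tendsto_pi_nhds.1 hlim2 i) j)).congr fun n => ?_
  rw [hX.integral_grid i j n (δ / n) fun k => s * (δ / n) * a k]
  have h1 : NormedSpace.exp ((n : ℝ)⁻¹ • (δ : ℝ) • generator lam q) =
      transition lam q (δ / n) := by
    rw [transition, smul_smul, NNReal.coe_div, NNReal.coe_natCast, div_eq_inv_mul]
  have h2 : NormedSpace.exp ((n : ℝ)⁻¹ • (δ : ℝ) • Matrix.diagonal fun k => s * a k) =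
      Matrix.diagonal fun k => Real.exp (s * (δ / n) * a k) := by
    rw [smul_smul, ← Matrix.diagonal_smul, Matrix.exp_diagonal]
    congr 1
    funext k
    rw [Pi.coe_exp, Real.exp_eq_exp_ℝ]
    simp only [Pi.smul_apply, smul_eq_mul]
    congr 1
    ring
  rw [h1, h2]

/-- The Perron vector of the tilted generator, with eigenvalue `r`, gives spectral radius `exp (δ
r)`, which is `1` only for `r = 0` because `δ > 0`. -/
theorem IsMarkovJumpProcess.rho_matA_eq_one_iff [Nonempty E] (hX : IsMarkovJumpProcess lam q P X)
    (hlam : ∀ i, 0 < lam i) (hq_irr : q.IsIrreducible) (hq_diag : ∀ i, q i i = 0) (s : ℝ)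
    {δ : ℝ≥0} (hδ : 0 < δ) :
    rho (matA a P X s δ) = 1 ↔
      ∃ v : E → ℝ, (∀ i, 0 < v i) ∧ (tiltedGenerator lam a q s).mulVec v = 0 := by
  have hnn : ∀ i j, 0 ≤ matA a P X s δ i j := fun i j => by
    refine integral_nonneg fun ω => mul_nonneg (Real.rpow_nonneg (Real.exp_nonneg _) s) ?_
    split_ifs <;> norm_num
  have hexp : ∀ (r : ℝ) (v : E → ℝ), (tiltedGenerator lam a q s).mulVec v = r • v →
      (matA a P X s δ).mulVec v = Real.exp (δ * r) • v := fun r v h => by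
    rw [hX.matA_eq_exp s δ hδ]
    exact matrix_exp_mulVec_of_eigenvector (by rw [Matrix.smul_mulVec, h, smul_smul])
  constructor
  · intro h
    obtain ⟨r, v, hv, hr⟩ := exists_pos_eigenvector_of_offDiag hq_irr hq_diag
      (tiltedGenerator_nonneg_of_ne (a := a) hlam hq_irr.nonneg s)
      (tiltedGenerator_pos_of_ne hlam s)
    rw [rho_eq_of_pos_eigenvector hnn hv (hexp r v hr), ENNReal.ofReal_eq_one,
      Real.exp_eq_one_iff] at h
    have hr0 : r = 0 := (mul_eq_zero.1 h).resolve_left (NNReal.coe_pos.2 hδ).ne'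
    exact ⟨v, hv, by rw [hr, hr0, zero_smul]⟩
  · rintro ⟨v, hv, h⟩
    rw [rho_eq_of_pos_eigenvector hnn hv (hexp 0 v (by rw [h, zero_smul]))]
    simp

theorem IsMarkovJumpProcess.real_eq_transition (hX : IsMarkovJumpProcess lam q P X) (t : ℝ≥0)
    (i j : E) : (P i).real {ω | X t ω = j} = transition lam q t i j := by
  have h := hX.integral_grid i j 1 t 0
  have hind : ∀ ω, (if X t ω = j then (1 : ℝ) else 0) = {ω | X t ω = j}.indicator 1 ω :=
    fun ω => by simp [Set.indicator_apply]
  simp only [Pi.zero_apply, Finset.sum_const_zero, Real.exp_zero, one_mul, Nat.cast_one,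
    Matrix.diagonal_one, mul_one, pow_one, hind,
    integral_indicator_one (hX.measurableSet_eq t j)] at h
  exact h

/-- Differentiate `μ exp (t G) = μ` at `t = 0`; invariance is known for `t ≥ 0` only, so the
derivative is taken from the right. -/
theorem IsInvariantLaw.vecMul_generator {μ : E → ℝ} (hμ : IsInvariantLaw P X μ)
    (hX : IsMarkovJumpProcess lam q P X) : Matrix.vecMul μ (generator lam q) = 0 := by
  funext j
  have hd : HasDerivAt (fun t : ℝ => ∑ i, μ i * NormedSpace.exp (t • generator lam q) i j)
      (∑ i, μ i * generator lam q i j) 0 :=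
    HasDerivAt.fun_sum fun i _ => (hasDerivAt_matrix_exp_smul _ i j).const_mul (μ i)
  have hc : HasDerivWithinAt (fun t : ℝ => ∑ i, μ i * NormedSpace.exp (t • generator lam q) i j)
      0 (Set.Ici 0) 0 := by
    refine (hasDerivWithinAt_const (0 : ℝ) (Set.Ici 0) (μ j)).congr (fun t ht => ?_) ?_
    · have h := hμ.invariant t.toNNReal j
      simp only [hX.real_eq_transition, transition, Real.coe_toNNReal t ht] at h
      exact h
    · have h := hμ.invariant 0 j
      simp only [hX.real_eq_transition, transition, NNReal.coe_zero] at h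
      exact h
  exact (uniqueDiffWithinAt_Ici (0 : ℝ)).eq_deriv _ hd.hasDerivWithinAt hc

end FeynmanKac

end MarkovSwitching

theorem corollary4 {E : Type*} [Fintype E] [DecidableEq E] [Nontrivial E]
    {Ω : Type*} [MeasurableSpace Ω]
    (lam a : E → ℝ) (q : Matrix E E ℝ) (P : E → Measure Ω) (X : ℝ≥0 → Ω → E) (μ : E → ℝ)
    (hlam : ∀ i, 0 < lam i)
    (hq : q ∈ Matrix.rowStochastic ℝ E) (hq_irr : q.IsIrreducible) (hq_diag : ∀ i, q i i = 0)
    (hX : IsMarkovJumpProcess lam q P X)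
    (hμ : IsInvariantLaw P X μ)
    (hα : ∑ i, a i * μ i < 0)
    (ha : ∃ i, 0 < a i) :
    ∃ κ ∈ Set.Ioo 0 (sOne lam a),
      (∀ s ∈ Set.Ioo 0 (sOne lam a), rho (matM lam a q s) = 1 ↔ s = κ) ∧
      (∀ δ : ℝ≥0, 0 < δ → ∀ s : ℝ, 0 < s → (rho (matA a P X s δ) = 1 ↔ s = κ)) := by
  obtain ⟨κ, hκ, h⟩ := exists_unique_pos_kernel hlam hq hq_irr hq_diag hμ.sum_eq_one
    (hμ.vecMul_generator hX) hα ha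
  refine ⟨κ, hκ, fun s hs => ?_, fun δ hδ s hs => ?_⟩
  · rw [rho_matM_eq_one_iff hlam hq_irr (sub_mul_pos_of_lt_sOne hlam hs.1 hs.2)]
    exact h s hs.1
  · rw [hX.rho_matA_eq_one_iff hlam hq_irr hq_diag s hδ]
    exact h s hs
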